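/- Let $G=(V,E)$ be a finite directed graph with $n$ vertices and $m$ edges, maximal in-degree $\mathit{Deg}_{in}$ and maximal out-degree $\mathit{Deg}_{out}$. Parallel AC-4-based trimming is the following fork-join program on shared variables $v.\mathit{status}$, $v.\mathit{deg}_{out}$ ($v\in V$). First, in parallel for all $v\in V$: set $v.\mathit{status}:=\mathrm{LIVE}$ and $v.\mathit{deg}_{out}:=|v.\mathit{post}|$, counting the successors one by one. After all this is completed, in parallel for all $v\in V$: if $v.\mathit{status}=\mathrm{LIVE}$, then set the private waiting set $Q_p:=\emptyset$ and execute $\mathrm{DoDegree}(v)$; then, while $Q_p\neq\emptyset$, remove some $w$ from $Q_p$ and, for each predecessor $v'$ of $w$ one after the other (in any order), atomically decrease $v'.\mathit{deg}_{out}$ by $1$ (fetch-and-add) and execute $\mathrm{DoDegree}(v')$. Here $\mathrm{DoDegree}(u)$ tests $u.\mathit{deg}_{out}=0$ and, if this holds, executes the atomic compare-and-swap of $u.\mathit{status}$ from $\mathrm{LIVE}$ to $\mathrm{DEAD}$; if that succeeds, it puts $u$ into $Q_p$. Every elementary operation costs one unit; in one time step every loop iteration executes at most one operation, and simultaneous accesses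 to the same shared variable are serialized in an arbitrary order (one access per variable and time step). The *work* of an execution is its number of operations. The *depth* is the number of time steps when the number of workers is unlimited, i.e. when an iteration waits only at the join or because the shared variable it needs is being accessed by another iteration. With $\mathcal P\ge 1$ workers, a dynamically load-balancing (greedy) scheduler executes at most $\mathcal P$ operations per time step, and fewer only if no further operation could be executed in that step; the *running time* is the number of time steps. For an execution, $|Q_p|$ denotes the maximum, over all iterations of the second loop, of the total number of vertices put into the waiting set of that iteration. Put $B=\max(1,|Q_p|)\cdot\max(1,\mathit{Deg}_{in})\cdot\max(1,\mathit{Deg}_{out})$. **Theorem.** There is an absolute constant $C>0$ such that for every finite directed graph $G$ and every initial content of the shared memory: 1. every execution, under any schedule whatsoever, has work at most $C(n+m)$; consequently the expected work under any random schedule is at most $C(n+m)$; 2. every execution with unlimitedly many workers has depth at most $C\cdot B$, i.e. the depth is $\mathcal O(|Q_p|\,\mathit{Deg}_{in}\,\mathit{Deg}_{out})$; 3. for every $\mathcal P\ge1$, every execution with $\mathcal P$ workers has running time at most $C\big(\tfrac{n+m}{\mathcal P}+B\big)$, i.e. the running time is $\mathcal O\big((n+m)/\mathcal P+|Q_p|\,\mathit{Deg}_{in}\,\mathit{Deg}_{out}\big)$.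 In each case the bounds hold at every moment of an execution (with the current value of $|Q_p|$), and an execution that is not finished can always be continued under the discipline in question; so all executions terminate within these bounds. -/

import Mathlib

open scoped ENNReal

namespace ParAC4

/-- Contents of the shared variable `v.status`. -/
inductive Status
  | live
  | dead

/-- The shared variables: `v.status` and `v.deg_out` for every vertex `v`. -/
inductive Var (V : Type*)
  | status (v : V)
  | deg (v : V)

section Graph

variable {V : Type*} [Fintype V] (G : Digraph V) [DecidableRel G.Adj]

/-- The successors `v.post`. -/
def post (v : V) : Finset V := Finset.univ.filter (fun w => G.Adj v w)

/-- The predecessors `v.pre`, i.e. the successors of `v` in the transposed graph. -/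
def pre (v : V) : Finset V := Finset.univ.filter (fun w => G.Adj w v)

/-- The number `m` of edges. -/
def numEdges : ℕ := (Finset.univ.filter (fun e : V × V => G.Adj e.1 e.2)).card

/-- The maximal out-degree. -/
def degOut : ℕ := Finset.univ.sup (fun v => (post G v).card)

/-- The maximal in-degree. -/
def degIn : ℕ := Finset.univ.sup (fun v => (pre G v).card)

end Graph

/-- Program counter of the loop iterations that belong to one vertex `v`: first the iteration
for `v` of the parallel initialization loop, then (after the join) the iteration for `v` of the
trimming loop.  A finite set `R` is the set of vertices a `for` loop still has to visit. -/
inductive PC (V : Type*)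
  /-- about to execute `v.status := LIVE` -/
  | setLive
  /-- computing `|v.post|`: `R` still to be counted, `k` counted so far -/
  | count (R : Finset V) (k : ℕ)
  /-- about to execute `v.deg_out := k` -/
  | setDeg (k : ℕ)
  /-- initialization of `v` finished, about to test `v.status = LIVE` -/
  | guard
  /-- about to execute `Q_p := ∅` -/
  | reset
  /-- in `DoDegree(u, Q_p)`, about to test `u.deg_out = 0` -/
  | testDeg (u : V) (R : Finset V)
  /-- in `DoDegree(u, Q_p)`, about to execute `CAS(u.status, LIVE, DEAD)` -/
  | cas (u : V) (R : Finset V)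
  /-- in `DoDegree(u, Q_p)`, about to execute `Q_p := Q_p ∪ {u}` -/
  | insertQ (u : V) (R : Finset V)
  /-- head of the `for` loop over the predecessors of the removed vertex -/
  | forPred (R : Finset V)
  /-- about to execute `FAA(u.deg_out, -1)` -/
  | faa (u : V) (R : Finset V)
  /-- head of the `while` loop -/
  | whileQ
  /-- finished -/
  | done

/-- Private state of the iterations of one vertex: the program counter, the private waiting set
`Q`, and (for the analysis only) the set of all the vertices put into the waiting set so far. -/
structure Iter (V : Type*) where
  pc : PC V
  Q : Finset V
  collected : Finset V

/-- A configuration: the shared memory and the private states of the iterations. -/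
structure Config (V : Type*) where
  status : V → Status
  deg : V → ℤ
  iter : V → Iter V

/-- At the beginning no iteration has executed anything; the shared memory is arbitrary. -/
def Initial {V : Type*} (c : Config V) : Prop := ∀ v, c.iter v = ⟨.setLive, ∅, ∅⟩

/-- All iterations have been completed. -/
def Finished {V : Type*} (c : Config V) : Prop := ∀ v, (c.iter v).pc = .done

/-- `Op G v c c'`: the iteration of `v` executes its next operation. -/
inductive Op {V : Type*} [Fintype V] [DecidableEq V] (G : Digraph V) [DecidableRel G.Adj]
    (v : V) (c : Config V) : Config V → Prop
  | setLive {Q H : Finset V} (h : c.iter v = ⟨.setLive, Q, H⟩) :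
      Op G v c ⟨Function.update c.status v .live, c.deg,
        Function.update c.iter v ⟨.count (post G v) 0, Q, H⟩⟩
  | countEdge {Q H R : Finset V} {k : ℕ} (h : c.iter v = ⟨.count R k, Q, H⟩) {w : V}
      (hw : w ∈ R) :
      Op G v c ⟨c.status, c.deg, Function.update c.iter v ⟨.count (R.erase w) (k + 1), Q, H⟩⟩
  | countExit {Q H : Finset V} {k : ℕ} (h : c.iter v = ⟨.count ∅ k, Q, H⟩) :
      Op G v c ⟨c.status, c.deg, Function.update c.iter v ⟨.setDeg k, Q, H⟩⟩
  | setDeg {Q H : Finset V} {k : ℕ} (h : c.iter v = ⟨.setDeg k, Q, H⟩) :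
      Op G v c ⟨c.status, Function.update c.deg v k, Function.update c.iter v ⟨.guard, Q, H⟩⟩
  | guardLive {Q H : Finset V} (h : c.iter v = ⟨.guard, Q, H⟩) (hs : c.status v = .live) :
      Op G v c ⟨c.status, c.deg, Function.update c.iter v ⟨.reset, Q, H⟩⟩
  | guardDead {Q H : Finset V} (h : c.iter v = ⟨.guard, Q, H⟩) (hs : c.status v = .dead) :
      Op G v c ⟨c.status, c.deg, Function.update c.iter v ⟨.done, Q, H⟩⟩
  | reset {Q H : Finset V} (h : c.iter v = ⟨.reset, Q, H⟩) :
      Op G v c ⟨c.status, c.deg, Function.update c.iter v ⟨.testDeg v ∅, ∅, ∅⟩⟩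
  | testZero {Q H R : Finset V} {u : V} (h : c.iter v = ⟨.testDeg u R, Q, H⟩)
      (hd : c.deg u = 0) :
      Op G v c ⟨c.status, c.deg, Function.update c.iter v ⟨.cas u R, Q, H⟩⟩
  | testNonzero {Q H R : Finset V} {u : V} (h : c.iter v = ⟨.testDeg u R, Q, H⟩)
      (hd : c.deg u ≠ 0) :
      Op G v c ⟨c.status, c.deg, Function.update c.iter v ⟨.forPred R, Q, H⟩⟩
  | casSucceeds {Q H R : Finset V} {u : V} (h : c.iter v = ⟨.cas u R, Q, H⟩)
      (hs : c.status u = .live) :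
      Op G v c ⟨Function.update c.status u .dead, c.deg,
        Function.update c.iter v ⟨.insertQ u R, Q, H⟩⟩
  | casFails {Q H R : Finset V} {u : V} (h : c.iter v = ⟨.cas u R, Q, H⟩)
      (hs : c.status u = .dead) :
      Op G v c ⟨c.status, c.deg, Function.update c.iter v ⟨.forPred R, Q, H⟩⟩
  | insertQ {Q H R : Finset V} {u : V} (h : c.iter v = ⟨.insertQ u R, Q, H⟩) :
      Op G v c ⟨c.status, c.deg,
        Function.update c.iter v ⟨.forPred R, insert u Q, insert u H⟩⟩
  | forNext {Q H R : Finset V} (h : c.iter v = ⟨.forPred R, Q, H⟩) {u : V} (hu : u ∈ R) :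
      Op G v c ⟨c.status, c.deg, Function.update c.iter v ⟨.faa u (R.erase u), Q, H⟩⟩
  | forExit {Q H : Finset V} (h : c.iter v = ⟨.forPred ∅, Q, H⟩) :
      Op G v c ⟨c.status, c.deg, Function.update c.iter v ⟨.whileQ, Q, H⟩⟩
  | faa {Q H R : Finset V} {u : V} (h : c.iter v = ⟨.faa u R, Q, H⟩) :
      Op G v c ⟨c.status, Function.update c.deg u (c.deg u - 1),
        Function.update c.iter v ⟨.testDeg u R, Q, H⟩⟩
  | whileNext {Q H : Finset V} (h : c.iter v = ⟨.whileQ, Q, H⟩) {w : V} (hw : w ∈ Q) :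
      Op G v c ⟨c.status, c.deg, Function.update c.iter v ⟨.forPred (pre G w), Q.erase w, H⟩⟩
  | whileExit {H : Finset V} (h : c.iter v = ⟨.whileQ, ∅, H⟩) :
      Op G v c ⟨c.status, c.deg, Function.update c.iter v ⟨.done, ∅, H⟩⟩

/-- The shared variable, if any, that the next operation of the iteration of `v` accesses. -/
def access {V : Type*} (c : Config V) (v : V) : Option (Var V) :=
  match (c.iter v).pc with
  | .setLive => some (.status v)
  | .setDeg _ => some (.deg v)
  | .guard => some (.status v)
  | .testDeg u _ => some (.deg u)
  | .cas u _ => some (.status u)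
  | .faa u _ => some (.deg u)
  | _ => none

/-- The next operations of the iterations of `u` and `v` access the same shared variable. -/
def SameVar {V : Type*} (c : Config V) (u v : V) : Prop :=
  ∃ x, access c u = some x ∧ access c v = some x

/-- The program counter is still in the initialization loop. -/
def PC.Initializing {V : Type*} : PC V → Prop
  | .setLive => True
  | .count _ _ => True
  | .setDeg _ => True
  | _ => False

/-- The iteration of `v` has a next operation that it may execute: it is not completed, and it
may enter the trimming loop only when the initialization loop has been completed (join). -/
def Enabled {V : Type*} (c : Config V) (v : V) : Prop :=
  (c.iter v).pc ≠ .done ∧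
    ((c.iter v).pc = .guard → ∀ u, ¬ (c.iter u).pc.Initializing)

/-- The iterations in `l` may execute one operation each during one time step: they are distinct
and enabled, and no two of them access the same shared variable (concurrent accesses to a
shared variable are serialized). -/
def Compatible {V : Type*} (c : Config V) (l : List V) : Prop :=
  l ≠ [] ∧ l.Nodup ∧ (∀ v ∈ l, Enabled c v) ∧ l.Pairwise (fun u v => ¬ SameVar c u v)

/-- The iterations in `l` execute one operation each. -/
inductive Ops {V : Type*} [Fintype V] [DecidableEq V] (G : Digraph V) [DecidableRel G.Adj] :
    List V → Config V → Config V → Prop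
  | nil (c : Config V) : Ops G [] c c
  | cons {v : V} {l : List V} {c c' c'' : Config V} (h : Op G v c c') (hl : Ops G l c' c'') :
      Ops G (v :: l) c c''

/-- A scheduling discipline: which iterations may be run together in a given configuration. -/
abbrev Discipline (V : Type*) := Config V → List V → Prop

/-- No restriction at all. -/
def anySchedule (V : Type*) : Discipline V := fun _ _ => True

/-- Unlimited number of workers: an enabled iteration waits only when the shared variable that
it needs is being accessed by another iteration. -/
def unlimitedWorkers (V : Type*) : Discipline V := fun c l =>
  ∀ v, Enabled c v → v ∈ l ∨ ∃ u ∈ l, SameVar c u v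

/-- `P` workers under a dynamically load-balancing (greedy) scheduler: at most `P` operations per
time step, and fewer only if nothing more could have been executed in that time step. -/
def greedyWorkers (V : Type*) (P : ℕ) : Discipline V := fun c l =>
  l.length ≤ P ∧ (l.length = P ∨ unlimitedWorkers V c l)

/-- `Exec G S c t c'`: there is a (possibly unfinished) execution from `c` to `c'` obeying the
discipline `S`, where `t` lists, time step after time step, the iterations that execute one
operation in that time step. -/
inductive Exec {V : Type*} [Fintype V] [DecidableEq V] (G : Digraph V) [DecidableRel G.Adj]
    (S : Discipline V) : Config V → List (List V) → Config V → Prop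
  | nil (c : Config V) : Exec G S c [] c
  | cons {c c' c'' : Config V} {l : List V} {t : List (List V)} (hc : Compatible c l)
      (hS : S c l) (hl : Ops G l c c') (ht : Exec G S c' t c'') : Exec G S c (l :: t) c''

/-- The number of operations of an execution. -/
def work {V : Type*} (t : List (List V)) : ℕ := (t.map List.length).sum

/-- The number of time steps of an execution. -/
def time {V : Type*} (t : List (List V)) : ℕ := t.length

/-- `|Q_p|`: the maximal number of vertices that a waiting set has received. -/
def waitBound {V : Type*} [Fintype V] (c : Config V) : ℕ :=
  Finset.univ.sup (fun v => (c.iter v).collected.card)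

/-- `|Q_p| · Deg_in · Deg_out`, where a factor that vanishes is read as `1`. -/
def depthBound {V : Type*} [Fintype V] (G : Digraph V) [DecidableRel G.Adj] (c : Config V) :
    ℕ :=
  max 1 (waitBound c) * max 1 (degIn G) * max 1 (degOut G)

/-- Every execution from `c₀` under the discipline `S`, finished or not, obeys
`cost ≤ bound`, and as long as it is unfinished it can be continued. -/
def RunsWithin {V : Type*} [Fintype V] [DecidableEq V] (G : Digraph V) [DecidableRel G.Adj]
    (S : Discipline V) (c₀ : Config V) (cost : List (List V) → ℕ) (bound : Config V → ℝ) :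
    Prop :=
  ∀ t c, Exec G S c₀ t c →
    (cost t : ℝ) ≤ bound c ∧ (Finished c ∨ ∃ l c', Exec G S c₀ (t ++ [l]) c')

end ParAC4

/-!
All bounds come from one potential, an upper bound for the weighted cost of the operations that
are still to be executed. An access to a shared variable of the vertex `x` has weight `z x`, any
other operation has weight `y`, where `y ≤ z x`. What remains for an iteration (`rem`) includes
what the vertices in its waiting set still cause; a vertex that can still be won by a
compare-and-swap carries its cost (`gain`) itself, and passes it on to the iteration that wins it.
A vertex is won at most once:
statuses become `LIVE` only before the join, and vertices are won only after it (`Inv`). So every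
operation decreases the potential by its own weight (`Op.potential_add_cost_le`), and since
distinct iterations do not change each other's private state, this adds up over a time step
(`Ops.potential_add_cost_le`).

*Work.* With all weights `1`, the potential is at most `12 (n + m)` at the beginning
(`potential_one_le`).

*Contention.* With weight `1` for the variables of a single vertex `s` and `0` for everything else,
the potential bounds the number of future accesses to the variables of `s`; at the beginning it is
at most `6 + 5 Deg_out`, because every successor of `s` is won at most once. Hence no iteration
waits longer than that for a shared variable.

*Depth.* The operations of one iteration are paid by the vertices it wins
(`Op.rem_add_cost_le`). If an access to a shared variable is given a weight larger than the longest
waiting time, while the operations that count successors keep weight `1`, the weighted progress of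
an iteration, together with the accesses that it has already waited for, is a clock that advances
in every time step in which the iteration is enabled and either operates or waits for a shared
variable (`Ops.clock_lt_of_enabled`). It runs from `-O(Deg_out)` to
`O(|Q_p| Deg_in Deg_out)`. An iteration that waits at the join is not enabled, but then the clock
of one that is still initializing advances, and that one is bounded by `O(Deg_out)` (`Timed`).

*Running time.* A time step of a greedy scheduler executes `P` operations, which happens at most
`work / P` times, or it is a time step as with unlimitedly many workers (`Exec.time_le`).
-/

namespace ParAC4

variable {V : Type*}

/-! ### Shared variables and phases -/

/-- The vertex whose shared variable the next operation of the iteration of `v` accesses. -/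
def target (v : V) : PC V → Option V
  | .setLive => some v
  | .setDeg _ => some v
  | .guard => some v
  | .testDeg u _ => some u
  | .cas u _ => some u
  | .faa u _ => some u
  | _ => none

/-- The vertex to which a shared variable belongs. -/
def Var.vertex : Var V → V
  | .status v => v
  | .deg v => v

theorem target_of_access {c : Config V} {v : V} {x : Var V} (h : access c v = some x) :
    target v (c.iter v).pc = some x.vertex := by
  unfold access at h
  cases hp : (c.iter v).pc <;> simp_all [target] <;> subst h <;> rfl

theorem SameVar.target_eq {c : Config V} {u v : V} (h : SameVar c u v) :
    ∃ s, target u (c.iter u).pc = some s ∧ target v (c.iter v).pc = some s := by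
  obtain ⟨x, hu, hv⟩ := h
  exact ⟨x.vertex, target_of_access hu, target_of_access hv⟩

theorem SameVar.symm {c : Config V} {u v : V} (h : SameVar c u v) : SameVar c v u := by
  obtain ⟨x, hu, hv⟩ := h
  exact ⟨x, hv, hu⟩

/-- The iteration has not yet executed `Q_p := ∅`. -/
def PC.Early : PC V → Prop
  | .setLive => True
  | .count _ _ => True
  | .setDeg _ => True
  | .guard => True
  | .reset => True
  | _ => False

/-- The vertices that an iteration has won by a successful compare-and-swap: the collected ones
and the one, if any, that it is about to put into its waiting set. -/
def Iter.won [DecidableEq V] (i : Iter V) : Finset V :=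
  match i.pc with
  | .insertQ u _ => insert u i.collected
  | _ => i.collected

/-- The invariant of all reachable configurations. -/
structure Inv [DecidableEq V] (c : Config V) : Prop where
  /-- The join separates the two loops. -/
  join : (∃ u, (c.iter u).pc.Initializing) →
    ∀ v, (c.iter v).pc.Initializing ∨ (c.iter v).pc = .guard
  /-- Nothing has been collected before `Q_p := ∅`. -/
  early : ∀ v, (c.iter v).pc.Early → (c.iter v).collected = ∅
  /-- Vertices won by a compare-and-swap are dead, so that none is won twice. -/
  dead : ∀ v, ∀ w ∈ (c.iter v).won, c.status w = .dead

theorem PC.Initializing.early {p : PC V} (h : p.Initializing) : p.Early := by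
  cases p <;> simp_all [PC.Initializing, PC.Early]

theorem PC.Early.not_done {p : PC V} (h : p.Early) : p ≠ .done := by
  rintro rfl
  exact h

section Ops

variable [DecidableEq V]

theorem Initial.inv {c : Config V} (h : Initial c) : Inv c where
  join _ v := by simp [h v, PC.Initializing]
  early v _ := by simp [h v]
  dead v := by simp [h v, Iter.won]

/-- After the initialization loop, an iteration that is about to operate excludes that another
one is still initializing. -/
theorem Inv.not_initializing {c : Config V} (hI : Inv c) {v : V} (hv : Enabled c v)
    (hi : ¬ (c.iter v).pc.Initializing) (u : V) : ¬ (c.iter u).pc.Initializing := by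
  intro hu
  rcases hI.join ⟨u, hu⟩ v with h | h
  · exact hi h
  · exact hv.2 h u hu

theorem Inv.won_eq_empty {c : Config V} (hI : Inv c) {v : V} (hv : (c.iter v).pc.Early) :
    (c.iter v).won = ∅ := by
  have := hI.early v hv
  unfold Iter.won
  split <;> simp_all [PC.Early]

variable [Fintype V] {G : Digraph V} [DecidableRel G.Adj]

theorem Op.iter_of_ne {v w : V} {c c' : Config V} (h : Op G v c c') (hw : w ≠ v) :
    c'.iter w = c.iter w := by
  cases h <;> simp [hw]

theorem Op.not_setLive {v : V} {c c' : Config V} (h : Op G v c c') :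
    (c'.iter v).pc ≠ .setLive := by
  cases h <;> simp

theorem Op.initializing {v : V} {c c' : Config V} (h : Op G v c c') {w : V}
    (hw : (c'.iter w).pc.Initializing) : (c.iter w).pc.Initializing := by
  by_cases hv : w = v
  · subst hv
    cases h <;> simp_all [PC.Initializing]
  · rwa [h.iter_of_ne hv] at hw

theorem Op.done {v : V} {c c' : Config V} (h : Op G v c c') {w : V}
    (hw : (c.iter w).pc = .done) : c'.iter w = c.iter w := by
  by_cases hv : w = v
  · subst hv
    cases h <;> simp_all
  · exact h.iter_of_ne hv

theorem Op.inv {v : V} {c c' : Config V} (h : Op G v c c') (hv : Enabled c v) (hI : Inv c) :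
    Inv c' where
  join := by
    rintro ⟨u, hu⟩ w
    have hu' := h.initializing hu
    have hvi : (c.iter v).pc.Initializing := by
      by_contra hvi
      exact hI.not_initializing hv hvi u hu'
    by_cases hw : w = v
    · subst hw
      cases h <;> simp_all [PC.Initializing]
    · rw [h.iter_of_ne hw]
      exact hI.join ⟨u, hu'⟩ w
  early w hw := by
    by_cases hwv : w = v
    · subst hwv
      have := hI.early w
      cases h <;> simp_all [PC.Early]
    · rw [h.iter_of_ne hwv] at hw ⊢
      exact hI.early w hw
  dead w x hx := by
    -- Only the initialization sets a status to `LIVE`, and nothing has been won by then.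
    by_cases hvi : (c.iter v).pc.Initializing
    · have hwe : (c.iter w).pc.Early := by
        rcases hI.join ⟨v, hvi⟩ w with h1 | h1
        · exact h1.early
        · simp [h1, PC.Early]
      have hwon : (c'.iter w).won = (c.iter w).won := by
        by_cases hwv : w = v
        · subst hwv
          cases h <;> simp_all [PC.Initializing, Iter.won]
        · rw [h.iter_of_ne hwv]
      rw [hwon, hI.won_eq_empty hwe] at hx
      simp at hx
    · have hst : ∀ x, c.status x = .dead → c'.status x = .dead := by
        intro x hx
        cases h <;> simp_all [PC.Initializing, Function.update_apply]
      by_cases hwv : w = v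
      · subst hwv
        have hd := hI.dead w
        cases h <;> simp_all [Iter.won, Function.update_apply]
        · rcases hx with rfl | hx
          · simp
          · intro; exact hd x hx
        · rcases hx with rfl | hx
          · exact hd.1
          · exact hd.2 x hx
      · rw [h.iter_of_ne hwv] at hx
        exact hst x (hI.dead w x hx)

end Ops

/-! ### The potential -/

section Potential

variable [Fintype V] (G : Digraph V) [DecidableRel G.Adj] (z : V → ℕ) (y : ℕ)

/-- The weighted cost of an operation that belongs to the iteration of `v`: an access to a shared
variable of `s` has weight `z s`, every other operation has weight `y`. -/
def opCost (v : V) (p : PC V) : ℕ := (target v p).elim y z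

/-- The weighted cost that a vertex `w` causes in the waiting set: its removal, the treatment of
its predecessors, and the end of the `for` loop. A predecessor `x` takes at most five operations
(choice in the `for` loop, fetch-and-add, test, compare-and-swap, insertion); all five are charged
`z x`, which is an upper bound as long as `y ≤ z x`. -/
def gain (w : V) : ℕ := (∑ x ∈ pre G w, 5 * z x) + 2 * y

/-- Upper bound for the weighted cost of the remaining operations in a `for` loop over `R`,
followed by the `while` loop with waiting set `Q`. -/
def loopCost (R Q : Finset V) : ℕ := (∑ x ∈ R, 5 * z x) + (∑ w ∈ Q, gain G z y w) + 2 * y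

/-- Upper bound for the weighted cost of the remaining operations of the iteration of `v`, as far
as they are not due to vertices that are still to be won by a compare-and-swap. A vertex that has
been won but not yet inserted (`insertQ`) is charged here. -/
def rem (v : V) (i : Iter V) : ℕ :=
  match i.pc with
  | .setLive => y * (post G v).card + 6 * z v + 4 * y
  | .count R _ => y * R.card + 5 * z v + 4 * y
  | .setDeg _ => 5 * z v + 3 * y
  | .guard => 4 * z v + 3 * y
  | .reset => 3 * z v + 3 * y
  | .testDeg u R => 3 * z u + loopCost G z y R i.Q
  | .cas u R => 2 * z u + loopCost G z y R i.Q
  | .insertQ u R => z u + gain G z y u + loopCost G z y R i.Q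
  | .forPred R => loopCost G z y R i.Q
  | .faa u R => 4 * z u + loopCost G z y R i.Q
  | .whileQ => (∑ w ∈ i.Q, gain G z y w) + y
  | .done => 0

open Classical in
/-- The weighted cost due to `w` if `w` can still be won by a compare-and-swap. -/
noncomputable def liveGain (c : Config V) (w : V) : ℕ :=
  if (c.iter w).pc = .setLive ∨ c.status w = .live then gain G z y w else 0

/-- The potential: an upper bound for the weighted cost of all remaining operations. -/
noncomputable def potential (c : Config V) : ℕ :=
  (∑ v, rem G z y v (c.iter v)) + ∑ w, liveGain G z y c w

variable {G z y}

theorem liveGain_congr {c c' : Config V} {w : V}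
    (h : ((c'.iter w).pc = .setLive ∨ c'.status w = .live) ↔
      ((c.iter w).pc = .setLive ∨ c.status w = .live)) :
    liveGain G z y c' w = liveGain G z y c w := by
  unfold liveGain
  by_cases hw : (c.iter w).pc = .setLive ∨ c.status w = .live
  · rw [if_pos hw, if_pos (h.2 hw)]
  · rw [if_neg hw, if_neg (mt h.1 hw)]

variable [DecidableEq V]

/-- The weighted cost of the operations of an iteration is paid by the vertices it wins. -/
theorem Op.rem_add_cost_le {v : V} {c c' : Config V} (h : Op G v c c') (hI : Inv c)
    (hz : ∀ x, y ≤ z x) :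
    rem G z y v (c'.iter v) + opCost z y v (c.iter v).pc + ∑ w ∈ (c.iter v).won, gain G z y w ≤
      rem G z y v (c.iter v) + ∑ w ∈ (c'.iter v).won, gain G z y w := by
  cases h with
  | setLive h => simp [h, rem, opCost, target, Iter.won]; omega
  | @countEdge Q H R k h w hw =>
    have := Finset.card_erase_add_one hw
    have : y * R.card = y * (R.erase w).card + y := by rw [← this]; ring
    simp [h, rem, opCost, target, Iter.won]; omega
  | countExit h => simp [h, rem, opCost, target, Iter.won]; omega
  | setDeg h => simp [h, rem, opCost, target, Iter.won]; omega
  | guardLive h hs => simp [h, rem, opCost, target, Iter.won]; omega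
  | guardDead h hs => simp [h, rem, opCost, target, Iter.won]; omega
  | reset h =>
    have := hI.early v (by simp [h, PC.Early])
    simp [h] at this
    simp [h, rem, opCost, target, Iter.won, loopCost, this]; omega
  | testZero h hd => simp [h, rem, opCost, target, Iter.won]; omega
  | testNonzero h hd => simp [h, rem, opCost, target, Iter.won]; omega
  | @casSucceeds Q H R u h hs =>
    have hu : u ∉ H := by
      intro hu
      have := hI.dead v u (by simpa [h, Iter.won] using hu)
      simp [hs] at this
    simp [h, rem, opCost, target, Iter.won, Finset.sum_insert hu]; omega
  | casFails h hs => simp [h, rem, opCost, target, Iter.won]; omega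
  | @insertQ Q H R u h =>
    have : ∑ w ∈ insert u Q, gain G z y w ≤ gain G z y u + ∑ w ∈ Q, gain G z y w := by
      by_cases hu : u ∈ Q
      · simp [Finset.insert_eq_of_mem hu]
      · rw [Finset.sum_insert hu]
    have := hz u
    simp [h, rem, opCost, target, Iter.won, loopCost]; omega
  | @forNext Q H R h u hu =>
    have := Finset.sum_erase_add R (fun x => 5 * z x) hu
    have := hz u
    simp [h, rem, opCost, target, Iter.won, loopCost]; omega
  | forExit h => simp [h, rem, opCost, target, Iter.won, loopCost]; omega
  | faa h => simp [h, rem, opCost, target, Iter.won]; omega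
  | @whileNext Q H h w hw =>
    have := Finset.sum_erase_add Q (gain G z y) hw
    have : gain G z y w = (∑ x ∈ pre G w, 5 * z x) + 2 * y := rfl
    simp [h, rem, opCost, target, Iter.won, loopCost]; omega
  | whileExit h => simp [h, rem, opCost, target, Iter.won]

/-- Changing one summand of a sum. -/
theorem sum_add_eq_sum_add (f f' : V → ℕ) (v : V) (h : ∀ w, w ≠ v → f' w = f w) :
    ∑ w, f' w + f v = ∑ w, f w + f' v := by
  rw [← Finset.add_sum_erase _ f (Finset.mem_univ v),
    ← Finset.add_sum_erase _ f' (Finset.mem_univ v),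
    Finset.sum_congr rfl (fun w hw => h w (Finset.ne_of_mem_erase hw))]
  ring

/-- A vertex is won only when it stops to be live. -/
theorem Op.won_add_liveGain_le {v : V} {c c' : Config V} (h : Op G v c c') (hv : Enabled c v)
    (hI : Inv c) :
    ∑ w ∈ (c'.iter v).won, gain G z y w + ∑ w, liveGain G z y c' w ≤
      ∑ w ∈ (c.iter v).won, gain G z y w + ∑ w, liveGain G z y c w := by
  by_cases hcas : ∃ u R Q H, c.iter v = ⟨.cas u R, Q, H⟩ ∧ c.status u = .live
  · obtain ⟨u, R, Q, H, hu, hs⟩ := hcas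
    have hu' : u ∉ H := by
      intro hu'
      have := hI.dead v u (by simpa [hu, Iter.won] using hu')
      simp [hs] at this
    have hpc : (c.iter u).pc ≠ .setLive := by
      intro hp
      exact hI.not_initializing hv (by simp [hu, PC.Initializing]) u
        (by simp [hp, PC.Initializing])
    cases h with
    | casSucceeds h hs' =>
      rw [h] at hu
      cases hu
      have key := sum_add_eq_sum_add (liveGain G z y c)
        (liveGain G z y ⟨Function.update c.status u .dead, c.deg,
          Function.update c.iter v ⟨.insertQ u R, Q, H⟩⟩) u (by
            intro w hw
            refine liveGain_congr ?_
            by_cases hwv : w = v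
            · subst hwv
              simp [h, hw]
            · simp [hw, hwv])
      have h1 : liveGain G z y c u = gain G z y u := by simp [liveGain, hs]
      have h2 : liveGain G z y ⟨Function.update c.status u .dead, c.deg,
          Function.update c.iter v ⟨.insertQ u R, Q, H⟩⟩ u = 0 := by
        by_cases huv : u = v
        · subst huv
          simp [liveGain]
        · simp [liveGain, huv, hpc]
      simp [h, Iter.won, Finset.sum_insert hu']
      omega
    | _ => simp_all
  · refine add_le_add ?_ (Finset.sum_le_sum fun w _ => ?_)
    · cases h <;> simp_all [Iter.won]
    · unfold liveGain
      by_cases hw : (c'.iter w).pc = .setLive ∨ c'.status w = .live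
      · rw [if_pos hw, if_pos]
        have hpc : (c'.iter w).pc = .setLive → (c.iter w).pc = .setLive := by
          intro hp
          by_cases hwv : w = v
          · subst hwv
            exact absurd hp h.not_setLive
          · rwa [h.iter_of_ne hwv] at hp
        rcases hw with hw | hw
        · exact Or.inl (hpc hw)
        · clear hpc
          by_cases hwv : w = v
          · subst hwv
            cases h <;> simp_all
          · cases h <;> simp_all
      · rw [if_neg hw]
        exact Nat.zero_le _

/-- Every operation decreases the potential by its weighted cost. -/
theorem Op.potential_add_cost_le {v : V} {c c' : Config V} (h : Op G v c c')
    (hv : Enabled c v) (hI : Inv c) (hz : ∀ x, y ≤ z x) :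
    potential G z y c' + opCost z y v (c.iter v).pc ≤ potential G z y c := by
  have h1 := h.rem_add_cost_le hI hz
  have h2 := h.won_add_liveGain_le (z := z) (y := y) hv hI
  have h3 := sum_add_eq_sum_add (fun w => rem G z y w (c.iter w))
    (fun w => rem G z y w (c'.iter w)) v (fun w hw => by rw [h.iter_of_ne hw])
  unfold potential
  omega

end Potential

/-! ### The initial potential -/

section InitialPotential

variable [Fintype V] {G : Digraph V} [DecidableRel G.Adj]

theorem sum_card_post : ∑ v, (post G v).card = numEdges G := by
  simp only [post, numEdges, Finset.card_filter, Fintype.sum_prod_type]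

theorem sum_card_pre : ∑ v, (pre G v).card = numEdges G := by
  simp only [pre, numEdges, Finset.card_filter, Fintype.sum_prod_type]
  exact Finset.sum_comm

theorem potential_one_le {c : Config V} (hc : Initial c) :
    potential G (fun _ => 1) 1 c ≤ 12 * (Fintype.card V + numEdges G) := by
  have h1 : ∑ v, rem G (fun _ => 1) 1 v (c.iter v) = numEdges G + 10 * Fintype.card V := by
    simp only [hc _, rem, Finset.sum_add_distrib]
    simp [sum_card_post]
    ring
  have h2 : ∑ w, liveGain G (fun _ => 1) 1 c w = 5 * numEdges G + 2 * Fintype.card V := by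
    simp only [liveGain, hc _, true_or, if_true, gain, Finset.sum_add_distrib]
    simp [← Finset.sum_mul, sum_card_pre]
    ring
  unfold potential
  omega

end InitialPotential

/-! ### Time steps -/

section Steps

variable [Fintype V] [DecidableEq V] {G : Digraph V} [DecidableRel G.Adj]

theorem Op.enabled_of_ne {v w : V} {c c' : Config V} (h : Op G v c c') (hw : w ≠ v)
    (he : Enabled c w) : Enabled c' w := by
  unfold Enabled
  rw [h.iter_of_ne hw]
  exact ⟨he.1, fun hg u hu => he.2 hg u (h.initializing hu)⟩

/-- The operations of a time step obey the discipline of the join also when they are executed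
one after the other. -/
theorem Op.enabled_tail {v : V} {l : List V} {c c' : Config V} (h : Op G v c c')
    (hn : (v :: l).Nodup) (he : ∀ w ∈ v :: l, Enabled c w) : ∀ w ∈ l, Enabled c' w :=
  fun w hw => h.enabled_of_ne (fun e => (List.nodup_cons.1 hn).1 (e ▸ hw))
    (he w (List.mem_cons_of_mem _ hw))

theorem Ops.inv {l : List V} {c c' : Config V} (h : Ops G l c c') (hn : l.Nodup)
    (he : ∀ v ∈ l, Enabled c v) (hI : Inv c) : Inv c' := by
  induction h with
  | nil => exact hI
  | cons h _ ih =>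
    exact ih hn.of_cons (h.enabled_tail hn he) (h.inv (he _ List.mem_cons_self) hI)

theorem Ops.iter_of_notMem {l : List V} {c c' : Config V} (h : Ops G l c c') {v : V}
    (hv : v ∉ l) : c'.iter v = c.iter v := by
  induction h with
  | nil => rfl
  | cons h _ ih =>
    rw [List.mem_cons, not_or] at hv
    rw [ih hv.2, h.iter_of_ne hv.1]

theorem Ops.initializing {l : List V} {c c' : Config V} (h : Ops G l c c') {w : V}
    (hw : (c'.iter w).pc.Initializing) : (c.iter w).pc.Initializing := by
  induction h with
  | nil => exact hw
  | cons h _ ih => exact h.initializing (ih hw)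

theorem Ops.done {l : List V} {c c' : Config V} (h : Ops G l c c') {w : V}
    (hw : (c.iter w).pc = .done) : (c'.iter w).pc = .done := by
  induction h with
  | nil => exact hw
  | cons h _ ih => exact ih (by rw [h.done hw, hw])

theorem Ops.potential_add_cost_le {z : V → ℕ} {y : ℕ} {l : List V} {c c' : Config V}
    (h : Ops G l c c') (hn : l.Nodup) (he : ∀ v ∈ l, Enabled c v) (hI : Inv c)
    (hz : ∀ x, y ≤ z x) :
    potential G z y c' + (l.map fun v => opCost z y v (c.iter v).pc).sum ≤
      potential G z y c := by
  induction h with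
  | nil => simp
  | @cons v l c c₁ c' h _ ih =>
    have hv := he v List.mem_cons_self
    have h1 := h.potential_add_cost_le hv hI hz
    have h2 := ih hn.of_cons (h.enabled_tail hn he) (h.inv hv hI)
    have h3 : (l.map fun w => opCost z y w (c₁.iter w).pc) =
        l.map fun w => opCost z y w (c.iter w).pc :=
      List.map_congr_left fun w hw => by
        rw [h.iter_of_ne fun e => (List.nodup_cons.1 hn).1 (e ▸ hw)]
    rw [h3] at h2
    rw [List.map_cons, List.sum_cons]
    omega

theorem Ops.rem_add_cost_le {z : V → ℕ} {y : ℕ} {l : List V} {c c' : Config V}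
    (h : Ops G l c c') (hn : l.Nodup) (he : ∀ v ∈ l, Enabled c v) (hI : Inv c)
    (hz : ∀ x, y ≤ z x) {v : V} (hv : v ∈ l) :
    rem G z y v (c'.iter v) + opCost z y v (c.iter v).pc + ∑ w ∈ (c.iter v).won, gain G z y w ≤
      rem G z y v (c.iter v) + ∑ w ∈ (c'.iter v).won, gain G z y w := by
  induction h with
  | nil => simp at hv
  | @cons u l c c₁ c' h hl ih =>
    by_cases hvu : v = u
    · subst hvu
      rw [hl.iter_of_notMem (List.nodup_cons.1 hn).1]
      exact h.rem_add_cost_le hI hz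
    · rw [← h.iter_of_ne hvu]
      exact ih hn.of_cons (h.enabled_tail hn he) (h.inv (he _ List.mem_cons_self) hI)
        ((List.mem_cons.1 hv).resolve_left hvu)

/-! ### Contention and work -/

variable (G) in
/-- Upper bound for the number of future accesses to the shared variables of `s`. -/
noncomputable def contention (s : V) (c : Config V) : ℕ :=
  potential G (fun x => if x = s then 1 else 0) 0 c

theorem contention_le {c : Config V} (hc : Initial c) (s : V) :
    contention G s c ≤ 6 + 5 * degOut G := by
  have h1 : ∑ v, rem G (fun x => if x = s then 1 else 0) 0 v (c.iter v) = 6 := by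
    simp [hc _, rem]
  have h2 : ∑ w, liveGain G (fun x => if x = s then 1 else 0) 0 c w = 5 * (post G s).card := by
    simp only [post, Finset.card_filter, Finset.mul_sum]
    refine Finset.sum_congr rfl fun w _ => ?_
    simp [liveGain, hc w, gain, pre]
  have h3 : (post G s).card ≤ degOut G :=
    Finset.le_sup (f := fun v => (post G v).card) (Finset.mem_univ s)
  unfold contention potential
  omega

theorem Ops.contention_le {l : List V} {c c' : Config V} (h : Ops G l c c') (hn : l.Nodup)
    (he : ∀ v ∈ l, Enabled c v) (hI : Inv c) (s : V) :
    contention G s c' ≤ contention G s c :=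
  (Nat.le_add_right _ _).trans (h.potential_add_cost_le hn he hI fun _ => Nat.zero_le _)

/-- An access to a shared variable of `s` decreases the number of future ones. -/
theorem Ops.contention_lt {l : List V} {c c' : Config V} (h : Ops G l c c') (hn : l.Nodup)
    (he : ∀ v ∈ l, Enabled c v) (hI : Inv c) {s u : V} (hu : u ∈ l)
    (hs : target u (c.iter u).pc = some s) :
    contention G s c' < contention G s c := by
  have h1 := h.potential_add_cost_le (z := fun x => if x = s then 1 else 0) hn he hI
    fun _ => Nat.zero_le _
  have h2 : 1 ≤ (l.map fun v =>
      opCost (fun x => if x = s then 1 else 0) 0 v (c.iter v).pc).sum :=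
    (by simp [opCost, hs] : 1 ≤ opCost (fun x => if x = s then 1 else 0) 0 u
      (c.iter u).pc).trans (List.single_le_sum (fun _ _ => Nat.zero_le _) _
        (List.mem_map_of_mem hu))
  unfold contention
  omega

/-- The work of a time step is taken from the potential with unit weights. -/
theorem Ops.potential_one_add_length_le {l : List V} {c c' : Config V} (h : Ops G l c c')
    (hn : l.Nodup) (he : ∀ v ∈ l, Enabled c v) (hI : Inv c) :
    potential G (fun _ => 1) 1 c' + l.length ≤ potential G (fun _ => 1) 1 c := by
  have h1 := h.potential_add_cost_le (z := fun _ => 1) hn he hI fun _ => le_rfl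
  have h2 : (l.map fun v => opCost (fun _ => 1) 1 v (c.iter v).pc) = l.map fun _ => 1 :=
    List.map_congr_left fun v _ => by
      unfold opCost
      cases target v (c.iter v).pc <;> rfl
  simpa [h2] using h1

theorem Exec.work_add_potential_le {S : Discipline V} {t : List (List V)} {c c' : Config V}
    (h : Exec G S c t c') (hI : Inv c) :
    work t + potential G (fun _ => 1) 1 c' ≤ potential G (fun _ => 1) 1 c := by
  induction h with
  | nil => simp [work]
  | cons hc _ hl _ ih =>
    have h1 := hl.potential_one_add_length_le hc.2.1 hc.2.2.1 hI
    have h2 := ih (hl.inv hc.2.1 hc.2.2.1 hI)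
    simp only [work, List.map_cons, List.sum_cons] at h2 ⊢
    omega

theorem Exec.work_le {S : Discipline V} {t : List (List V)} {c c' : Config V}
    (h : Exec G S c t c') (hc : Initial c) :
    work t ≤ 12 * (Fintype.card V + numEdges G) :=
  (Nat.le_add_right _ _).trans ((h.work_add_potential_le hc.inv).trans (potential_one_le hc))

end Steps

/-! ### The clock of an iteration -/

section Clock

variable [Fintype V] [DecidableEq V] {G : Digraph V} [DecidableRel G.Adj]

variable (G) in
/-- Upper bound for the number of accesses to the shared variables of a single vertex. -/
def accessBound : ℕ := 6 + 5 * degOut G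

variable (G) in
/-- The weighted progress of an iteration: the weight of the vertices it has won minus the weight
of its remaining operations, where an access to a shared variable weighs one more than the
longest possible waiting time, and any other operation has weight `1`. -/
def progress (v : V) (i : Iter V) : ℤ :=
  ((∑ w ∈ i.won, gain G (fun _ => accessBound G + 1) 1 w : ℕ) : ℤ) -
    (rem G (fun _ => accessBound G + 1) 1 v i : ℕ)

variable (G) in
/-- The clock of the iteration of `v`: its weighted progress, and, if it is about to access a
shared variable of `s`, the number of accesses to variables of `s` that can no longer come. -/
noncomputable def clock (c : Config V) (v : V) : ℤ :=
  progress G v (c.iter v) +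
    (target v (c.iter v).pc).elim 0 fun s => (accessBound G : ℤ) - (contention G s c : ℤ)

theorem clock_le_progress (c : Config V) (v : V) :
    clock G c v ≤ progress G v (c.iter v) + accessBound G := by
  unfold clock
  cases target v (c.iter v).pc <;> simp

theorem progress_le_clock {c : Config V} (hM : ∀ s, contention G s c ≤ accessBound G) (v : V) :
    progress G v (c.iter v) ≤ clock G c v := by
  unfold clock
  cases target v (c.iter v).pc with
  | none => simp
  | some s =>
    have := hM s
    simp
    omega

/-- The clock of an iteration that operates advances: the weight of its operation exceeds
whatever its waiting has contributed before. -/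
theorem Ops.clock_lt_of_mem {l : List V} {c c' : Config V} (h : Ops G l c c') (hn : l.Nodup)
    (he : ∀ v ∈ l, Enabled c v) (hI : Inv c) (hM : ∀ s, contention G s c ≤ accessBound G)
    {v : V} (hv : v ∈ l) : clock G c v < clock G c' v := by
  have h1 := h.rem_add_cost_le (z := fun _ => accessBound G + 1) (y := 1) hn he hI
    (fun _ => by omega) hv
  have h2 := progress_le_clock (G := G) (fun s => (h.contention_le hn he hI s).trans (hM s)) v
  refine lt_of_lt_of_le ?_ h2
  unfold clock progress
  unfold opCost at h1
  cases ht : target v (c.iter v).pc with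
  | none =>
    simp only [ht, Option.elim] at h1 ⊢
    omega
  | some s =>
    simp only [ht, Option.elim] at h1 ⊢
    omega

theorem Ops.clock_le {l : List V} {c c' : Config V} (h : Ops G l c c') (hn : l.Nodup)
    (he : ∀ v ∈ l, Enabled c v) (hI : Inv c) (hM : ∀ s, contention G s c ≤ accessBound G)
    (v : V) : clock G c v ≤ clock G c' v := by
  by_cases hv : v ∈ l
  · exact (h.clock_lt_of_mem hn he hI hM hv).le
  · unfold clock
    rw [h.iter_of_notMem hv]
    cases target v (c.iter v).pc with
    | none => simp
    | some s =>
      have := h.contention_le hn he hI s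
      simp only [Option.elim]
      omega

/-- If an iteration waits only for accesses to the variable it needs, then its clock advances. -/
theorem Ops.clock_lt_of_enabled {l : List V} {c c' : Config V} (h : Ops G l c c')
    (hn : l.Nodup) (he : ∀ v ∈ l, Enabled c v) (hI : Inv c)
    (hM : ∀ s, contention G s c ≤ accessBound G) (hu : unlimitedWorkers V c l) {v : V}
    (hv : Enabled c v) : clock G c v < clock G c' v := by
  by_cases hvl : v ∈ l
  · exact h.clock_lt_of_mem hn he hI hM hvl
  · obtain ⟨u, hul, hs⟩ := (hu v hv).resolve_left hvl
    obtain ⟨s, hsu, hsv⟩ := hs.target_eq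
    have := h.contention_lt hn he hI hul hsu
    unfold clock
    rw [h.iter_of_notMem hvl, hsv]
    simp only [Option.elim]
    omega

/-! ### The number of time steps without idle resources -/

variable (G) in
/-- Bound for the weight of the operations of an iteration that are not due to its waiting set. The
operations that count successors have weight `1`, so that this is linear in the out-degree. -/
def baseCost : ℕ := 6 * (accessBound G + 1) + degOut G + 4

variable (G) in
/-- Bound for the number of time steps until all the iterations have passed the join. -/
def joinTime : ℕ := accessBound G + baseCost G + 1

/-- After `N` time steps in which enabled iterations waited for shared variables only, the clocks
have advanced accordingly.  Until the join this holds for the iterations that are initializing;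
afterwards it holds for all iterations, up to the time of the join. -/
structure Timed (G : Digraph V) [DecidableRel G.Adj] (N : ℕ) (c : Config V) : Prop where
  inv : Inv c
  contention_le : ∀ s, contention G s c ≤ accessBound G
  clock_nonneg : ∀ v, 0 ≤ clock G c v + baseCost G
  initializing : ∀ v, (c.iter v).pc.Initializing → (N : ℤ) ≤ clock G c v + baseCost G
  trimming : (∀ u, ¬ (c.iter u).pc.Initializing) → ∀ v, (c.iter v).pc ≠ .done →
    (N : ℤ) ≤ clock G c v + baseCost G + joinTime G
  total : N ≤ joinTime G ∨ ∃ v, (N : ℤ) ≤ clock G c v + baseCost G + joinTime G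

theorem Initial.timed {c : Config V} (hc : Initial c) : Timed G 0 c := by
  have hM : ∀ s, contention G s c ≤ accessBound G := contention_le hc
  have h0 : ∀ v, 0 ≤ clock G c v + baseCost G := by
    intro v
    have h1 := progress_le_clock hM v
    have h2 : (post G v).card ≤ degOut G :=
      Finset.le_sup (f := fun v => (post G v).card) (Finset.mem_univ v)
    have h3 : -(baseCost G : ℤ) ≤ progress G v (c.iter v) := by
      simp only [progress, hc v, Iter.won, rem, baseCost, Finset.sum_empty]
      push_cast
      omega
    omega
  exact
    { inv := hc.inv
      contention_le := hM
      clock_nonneg := h0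
      initializing := fun v _ => by simpa using h0 v
      trimming := fun _ v _ => by have := h0 v; omega
      total := Or.inl (Nat.zero_le _) }

/-- While an iteration is initializing, only the time of the join has passed. -/
theorem Timed.lt_joinTime {N : ℕ} {c : Config V} (h : Timed G N c) {u : V}
    (hu : (c.iter u).pc.Initializing) : N < joinTime G := by
  have h1 := h.initializing u hu
  have h2 := clock_le_progress (G := G) c u
  have h3 : progress G u (c.iter u) ≤ 0 := by
    unfold progress
    rw [h.inv.won_eq_empty hu.early]
    simp
  unfold joinTime
  omega

theorem Timed.step {N N' : ℕ} {l : List V} {c c' : Config V} (hT : Timed G N c)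
    (hc : Compatible c l) (h : Ops G l c c')
    (hN : N' = N ∨ N' = N + 1 ∧ unlimitedWorkers V c l) : Timed G N' c' := by
  obtain ⟨hl, hn, he, -⟩ := hc
  have hmono := h.clock_le hn he hT.inv hT.contention_le
  have hadv : ∀ v, Enabled c v → (N' : ℤ) - N ≤ clock G c' v - clock G c v := by
    intro v hv
    rcases hN with rfl | ⟨rfl, hu⟩
    · have := hmono v
      omega
    · have := h.clock_lt_of_enabled hn he hT.inv hT.contention_le hu hv
      push_cast
      omega
  have hN' : N' ≤ N + 1 := by omega
  have hnonneg : ∀ v, 0 ≤ clock G c' v + baseCost G := fun v => by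
    have h1 := hT.clock_nonneg v
    have h2 := hmono v
    omega
  -- The progress made since the join, for an iteration that is not finished.
  have htrim : ∀ v, (c.iter v).pc ≠ .done →
      (∀ u, (c.iter u).pc.Initializing → N' ≤ joinTime G) ∧
      ((∀ u, ¬ (c.iter u).pc.Initializing) →
        (N' : ℤ) ≤ clock G c' v + baseCost G + joinTime G) := by
    intro v hv
    refine ⟨fun u hu => by have := hT.lt_joinTime hu; omega, fun hu => ?_⟩
    have h1 := hadv v ⟨hv, fun _ => hu⟩
    have h2 := hT.trimming hu v hv
    omega
  refine
    { inv := h.inv hn he hT.inv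
      contention_le := fun s => (h.contention_le hn he hT.inv s).trans (hT.contention_le s)
      clock_nonneg := hnonneg
      initializing := fun v hv => ?_
      trimming := fun _ v hv => ?_
      total := ?_ }
  · have hv' := h.initializing hv
    have h1 := hadv v ⟨hv'.early.not_done, fun hg => by simp [hg, PC.Initializing] at hv'⟩
    have h2 := hT.initializing v hv'
    omega
  · have hv' := htrim v (mt h.done hv)
    by_cases hi : ∃ u, (c.iter u).pc.Initializing
    · obtain ⟨u, hu⟩ := hi
      have h1 := hv'.1 u hu
      have h2 := hnonneg v
      omega
    · exact hv'.2 (not_exists.1 hi)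
  · obtain ⟨v, hv⟩ := List.exists_mem_of_ne_nil l hl
    have hv' := htrim v (he v hv).1
    by_cases hi : ∃ u, (c.iter u).pc.Initializing
    · obtain ⟨u, hu⟩ := hi
      exact Or.inl (hv'.1 u hu)
    · exact Or.inr ⟨v, hv'.2 (not_exists.1 hi)⟩

/-- The clock is bounded by the weight of the vertices won, at most `124 * depthBound G c`; the
bounds for accesses, for the initialization and for the join add multiples `12`, `77` and `89` of
`max 1 (degOut G)`. -/
theorem Timed.le_depthBound {N : ℕ} {c : Config V} (h : Timed G N c) :
    N ≤ 302 * depthBound G c := by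
  obtain ⟨Q, hQ⟩ : ∃ Q, Q = max 1 (waitBound c) := ⟨_, rfl⟩
  obtain ⟨D, hD⟩ : ∃ D, D = max 1 (degIn G) := ⟨_, rfl⟩
  obtain ⟨K, hK⟩ : ∃ K, K = max 1 (degOut G) := ⟨_, rfl⟩
  have hdB : depthBound G c = Q * D * K := by rw [depthBound, hQ, hD, hK]
  have hM : accessBound G + 1 ≤ 12 * K := by unfold accessBound; omega
  have hA : baseCost G ≤ 77 * K := by unfold baseCost; omega
  have hJ : joinTime G ≤ 89 * K := by unfold joinTime; omega
  have hDK : K ≤ D * K := Nat.le_mul_of_pos_left _ (by omega)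
  have hB : D * K ≤ Q * D * K := by
    rw [mul_assoc]
    exact Nat.le_mul_of_pos_left _ (by omega)
  rw [hdB]
  rcases h.total with h | ⟨v, h⟩
  · omega
  · have h1 := clock_le_progress (G := G) c v
    have hg : ∀ w, gain G (fun _ => accessBound G + 1) 1 w ≤ 62 * (D * K) := by
      intro w
      have h2 : (pre G w).card ≤ D :=
        (Finset.le_sup (f := fun v => (pre G v).card) (Finset.mem_univ w)).trans
          (hD ▸ le_max_right _ _)
      have h3 := Nat.mul_le_mul h2 hM
      unfold gain
      rw [Finset.sum_const, smul_eq_mul]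
      have : (pre G w).card * (5 * (accessBound G + 1)) =
        5 * ((pre G w).card * (accessBound G + 1)) := by ring
      have : D * (12 * K) = 12 * (D * K) := by ring
      omega
    have hw : (c.iter v).won.card ≤ 2 * Q := by
      have h2 : (c.iter v).collected.card ≤ waitBound c :=
        Finset.le_sup (f := fun v => (c.iter v).collected.card) (Finset.mem_univ v)
      have h3 : (c.iter v).won.card ≤ (c.iter v).collected.card + 1 := by
        unfold Iter.won
        split
        · exact Finset.card_insert_le _ _
        · omega
      omega
    have hs : ∑ w ∈ (c.iter v).won, gain G (fun _ => accessBound G + 1) 1 w ≤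
        124 * (Q * D * K) :=
      calc _ ≤ (c.iter v).won.card * (62 * (D * K)) := by
            simpa using Finset.sum_le_card_nsmul _ _ _ fun w _ => hg w
        _ ≤ 2 * Q * (62 * (D * K)) := Nat.mul_le_mul_right _ hw
        _ = 124 * (Q * D * K) := by ring
    have hp : progress G v (c.iter v) ≤ 124 * (Q * D * K : ℕ) := by
      unfold progress
      omega
    omega

/-- The time steps that are not `full`, in which therefore enabled iterations wait for shared
variables only, are bounded by the depth. -/
theorem Exec.time_le {S : Discipline V} (full : List V → Bool)
    (hS : ∀ c l, S c l → full l ∨ unlimitedWorkers V c l) {t : List (List V)} {c c' : Config V}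
    (h : Exec G S c t c') {N : ℕ} (hT : Timed G N c) :
    N + time t ≤ 302 * depthBound G c' + t.countP full := by
  induction h generalizing N with
  | nil => simpa [time] using hT.le_depthBound
  | @cons c c₁ c' l t hc hs hl _ ih =>
    simp only [time, List.length_cons, List.countP_cons] at ih ⊢
    by_cases hf : full l
    · have := ih (hT.step hc hl (Or.inl rfl))
      simp only [hf, if_true]
      omega
    · have := ih (hT.step hc hl (Or.inr ⟨rfl, (hS c l hs).resolve_left hf⟩))
      omega

end Clock

/-! ### Continuing an execution -/

theorem exists_enabled {c : Config V} (h : ¬ Finished c) : ∃ v, Enabled c v := by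
  by_cases hi : ∃ u, (c.iter u).pc.Initializing
  · obtain ⟨u, hu⟩ := hi
    exact ⟨u, hu.early.not_done, fun hg => by simp [hg, PC.Initializing] at hu⟩
  · obtain ⟨v, hv⟩ := not_forall.1 h
    exact ⟨v, hv, fun _ => not_exists.1 hi⟩

theorem Compatible.take {c : Config V} {l : List V} (h : Compatible c l) {P : ℕ} (hP : 1 ≤ P) :
    Compatible c (l.take P) := by
  refine ⟨?_, h.2.1.sublist (List.take_sublist P l),
    fun v hv => h.2.2.1 v (List.mem_of_mem_take hv), h.2.2.2.sublist (List.take_sublist P l)⟩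
  rw [Ne, List.take_eq_nil_iff]
  rintro (h0 | h0)
  · omega
  · exact h.1 h0

section Continue

variable [Fintype V]

/-- A longest list of iterations that may operate together leaves out only iterations that need
a shared variable which is being accessed. -/
theorem exists_compatible_unlimitedWorkers {c : Config V} (h : ¬ Finished c) :
    ∃ l, Compatible c l ∧ unlimitedWorkers V c l := by
  obtain ⟨v₀, hv₀⟩ := exists_enabled h
  -- A compatible list has no repetitions, so `card V - length` is a measure that can be minimized.
  have hex : ∃ n l, Compatible c l ∧ Fintype.card V - l.length = n :=
    ⟨_, [v₀], ⟨by simp, by simp, by simpa using hv₀, by simp⟩, rfl⟩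
  classical
  obtain ⟨l, hl, hn⟩ := Nat.find_spec hex
  refine ⟨l, hl, fun v hv => ?_⟩
  by_contra! hcon
  have hc : Compatible c (v :: l) := by
    refine ⟨by simp, List.nodup_cons.2 ⟨hcon.1, hl.2.1⟩, ?_, ?_⟩
    · rintro w (_ | ⟨_, hw⟩)
      · exact hv
      · exact hl.2.2.1 w hw
    · exact List.pairwise_cons.2 ⟨fun u hu hs => hcon.2 u hu hs.symm, hl.2.2.2⟩
  have h1 := Nat.find_min' hex ⟨v :: l, hc, rfl⟩
  have h2 := hc.2.1.length_le_card
  simp only [List.length_cons] at h1 h2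
  omega

theorem exists_compatible_greedyWorkers {c : Config V} (h : ¬ Finished c) {P : ℕ}
    (hP : 1 ≤ P) : ∃ l, Compatible c l ∧ greedyWorkers V P c l := by
  obtain ⟨l, hl, hu⟩ := exists_compatible_unlimitedWorkers h
  rcases le_total l.length P with hlen | hlen
  · exact ⟨l, hl, hlen, Or.inr hu⟩
  · exact ⟨l.take P, hl.take hP, by simp [hlen], Or.inl (by simp [hlen])⟩

variable [DecidableEq V] {G : Digraph V} [DecidableRel G.Adj]

theorem exists_op {c : Config V} {v : V} (hv : (c.iter v).pc ≠ .done) : ∃ c', Op G v c c' := by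
  rcases hi : c.iter v with ⟨p, Q, H⟩
  cases p with
  | setLive => exact ⟨_, .setLive hi⟩
  | count R k =>
    rcases R.eq_empty_or_nonempty with rfl | ⟨w, hw⟩
    · exact ⟨_, .countExit hi⟩
    · exact ⟨_, .countEdge hi hw⟩
  | setDeg k => exact ⟨_, .setDeg hi⟩
  | guard =>
    cases hs : c.status v with
    | live => exact ⟨_, .guardLive hi hs⟩
    | dead => exact ⟨_, .guardDead hi hs⟩
  | reset => exact ⟨_, .reset hi⟩
  | testDeg u R =>
    by_cases hd : c.deg u = 0
    · exact ⟨_, .testZero hi hd⟩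
    · exact ⟨_, .testNonzero hi hd⟩
  | cas u R =>
    cases hs : c.status u with
    | live => exact ⟨_, .casSucceeds hi hs⟩
    | dead => exact ⟨_, .casFails hi hs⟩
  | insertQ u R => exact ⟨_, .insertQ hi⟩
  | forPred R =>
    rcases R.eq_empty_or_nonempty with rfl | ⟨w, hw⟩
    · exact ⟨_, .forExit hi⟩
    · exact ⟨_, .forNext hi hw⟩
  | faa u R => exact ⟨_, .faa hi⟩
  | whileQ =>
    rcases Q.eq_empty_or_nonempty with rfl | ⟨w, hw⟩
    · exact ⟨_, .whileExit hi⟩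
    · exact ⟨_, .whileNext hi hw⟩
  | done => simp [hi] at hv

theorem exists_ops {l : List V} (hn : l.Nodup) {c : Config V}
    (h : ∀ v ∈ l, (c.iter v).pc ≠ .done) : ∃ c', Ops G l c c' := by
  induction l generalizing c with
  | nil => exact ⟨c, .nil c⟩
  | cons v l ih =>
    obtain ⟨c₁, h₁⟩ := exists_op (G := G) (h v List.mem_cons_self)
    obtain ⟨c₂, h₂⟩ := ih hn.of_cons (c := c₁) fun w hw => by
      rw [h₁.iter_of_ne fun e => (List.nodup_cons.1 hn).1 (e ▸ hw)]
      exact h w (List.mem_cons_of_mem _ hw)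
    exact ⟨c₂, .cons h₁ h₂⟩

theorem Exec.append {S : Discipline V} {t t' : List (List V)} {c c' c'' : Config V}
    (h : Exec G S c t c') (h' : Exec G S c' t' c'') : Exec G S c (t ++ t') c'' := by
  induction h with
  | nil => exact h'
  | cons hc hS hl _ ih => exact .cons hc hS hl (ih h')

theorem Exec.exists_append {S : Discipline V} {t : List (List V)} {c c' : Config V}
    (h : Exec G S c t c') (hS : ¬ Finished c' → ∃ l, Compatible c' l ∧ S c' l) :
    Finished c' ∨ ∃ l c'', Exec G S c (t ++ [l]) c'' := by
  by_cases hf : Finished c'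
  · exact Or.inl hf
  · obtain ⟨l, hl, hSl⟩ := hS hf
    obtain ⟨c'', hc''⟩ := exists_ops (G := G) hl.2.1 fun v hv => (hl.2.2.1 v hv).1
    exact Or.inr ⟨l, c'', h.append (.cons hl hSl hc'' (.nil c''))⟩

end Continue

/-! ### Counting full time steps, and averaging -/

/-- Time steps with `P` operations each contribute `P` to the work. -/
theorem mul_countP_length_le_work (P : ℕ) (t : List (List V)) :
    P * t.countP (fun l => l.length == P) ≤ work t := by
  induction t with
  | nil => simp
  | cons l t ih =>
    simp only [work, List.map_cons, List.sum_cons, List.countP_cons] at ih ⊢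
    by_cases h : l.length = P
    · simp [h, mul_add]
      omega
    · simp [h]
      omega

/-- A bound that holds for all outcomes holds for the expectation. -/
theorem tsum_pmf_mul_le {α : Type*} (μ : PMF α) (f : α → ℝ≥0∞) (b : ℝ≥0∞)
    (h : ∀ a ∈ μ.support, f a ≤ b) : ∑' a, μ a * f a ≤ b :=
  calc ∑' a, μ a * f a ≤ ∑' a, μ a * b := ENNReal.tsum_le_tsum fun a => by
        by_cases ha : μ a = 0
        · simp [ha]
        · gcongr
          exact h a ((μ.mem_support_iff a).2 ha)
    _ = b := by rw [ENNReal.tsum_mul_right, μ.tsum_coe, one_mul]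

end ParAC4

theorem mainTheorem10 :
    ∃ C : ℝ, 0 < C ∧
      ∀ (V : Type*) [Fintype V] [DecidableEq V] (G : Digraph V) [DecidableRel G.Adj]
        (c₀ : ParAC4.Config V), ParAC4.Initial c₀ →
        -- work, in every execution
        ParAC4.RunsWithin G (ParAC4.anySchedule V) c₀ ParAC4.work
          (fun _ => C * ((Fintype.card V : ℝ) + (ParAC4.numEdges G : ℝ))) ∧
        -- expected work, for every random schedule
        (∀ μ : PMF (List (List V)),
          (∀ t ∈ μ.support, ∃ c, ParAC4.Exec G (ParAC4.anySchedule V) c₀ t c) →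
          ∑' t, μ t * (ParAC4.work t : ℝ≥0∞) ≤
            ENNReal.ofReal (C * ((Fintype.card V : ℝ) + (ParAC4.numEdges G : ℝ)))) ∧
        -- depth
        ParAC4.RunsWithin G (ParAC4.unlimitedWorkers V) c₀ ParAC4.time
          (fun c => C * (ParAC4.depthBound G c : ℝ)) ∧
        -- running time with `P` workers
        (∀ P : ℕ, 1 ≤ P →
          ParAC4.RunsWithin G (ParAC4.greedyWorkers V P) c₀ ParAC4.time
            (fun c => C * (((Fintype.card V : ℝ) + (ParAC4.numEdges G : ℝ)) / (P : ℝ) +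
              (ParAC4.depthBound G c : ℝ)))) := by 
  refine ⟨302, by norm_num, fun V _ _ G _ c₀ h₀ => ?_⟩
  have hwork : ∀ {S : ParAC4.Discipline V} {t c}, ParAC4.Exec G S c₀ t c →
      (ParAC4.work t : ℝ) ≤ 12 * ((Fintype.card V : ℝ) + (ParAC4.numEdges G : ℝ)) :=
    fun h => by exact_mod_cast h.work_le h₀
  have hwork' : ∀ {S : ParAC4.Discipline V} {t c}, ParAC4.Exec G S c₀ t c →
      (ParAC4.work t : ℝ) ≤ 302 * ((Fintype.card V : ℝ) + (ParAC4.numEdges G : ℝ)) :=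
    fun h => (hwork h).trans (by gcongr; norm_num)
  refine ⟨fun t c h => ⟨hwork' h, h.exists_append fun hf => ?_⟩, fun μ hμ => ?_,
    fun t c h => ⟨?_, h.exists_append ParAC4.exists_compatible_unlimitedWorkers⟩,
    fun P hP t c h => ⟨?_, h.exists_append fun hf =>
      ParAC4.exists_compatible_greedyWorkers hf hP⟩⟩
  · obtain ⟨l, hl, -⟩ := ParAC4.exists_compatible_unlimitedWorkers hf
    exact ⟨l, hl, trivial⟩
  · refine ParAC4.tsum_pmf_mul_le μ _ _ fun t ht => ?_
    obtain ⟨c, h⟩ := hμ t ht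
    rw [← ENNReal.ofReal_natCast]
    exact ENNReal.ofReal_le_ofReal (hwork' h)
  · have := h.time_le (fun _ => false) (fun _ _ h => Or.inr h) h₀.timed
    simp only [List.countP_false, zero_add, Function.const_apply, add_zero] at this
    dsimp only
    exact_mod_cast this
  · have h1 := h.time_le (fun l => l.length == P)
      (fun c l h => h.2.imp (fun h => by simpa using h) id) h₀.timed
    have h2 := ParAC4.mul_countP_length_le_work P t
    -- The time steps with `P` operations are paid by the work.
    have h3 : ((t.countP fun l => l.length == P : ℕ) : ℝ) ≤
        12 * (((Fintype.card V : ℝ) + (ParAC4.numEdges G : ℝ)) / (P : ℝ)) := by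
      rw [← mul_div_assoc, le_div_iff₀ (by exact_mod_cast hP), mul_comm]
      refine le_trans ?_ (hwork h)
      exact_mod_cast h2
    have h4 : (ParAC4.time t : ℝ) ≤ 302 * (ParAC4.depthBound G c : ℝ) +
        ((t.countP fun l => l.length == P : ℕ) : ℝ) := by
      rw [zero_add] at h1
      exact_mod_cast h1
    have h5 : 0 ≤ ((Fintype.card V : ℝ) + (ParAC4.numEdges G : ℝ)) / (P : ℝ) := by positivity
    linarith
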